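/- Let $2^{\mathbb N}$ be the Cantor cube, i.e. the set of all binary sequences with the product topology and the group operation of coordinatewise addition modulo $2$, and let $\mu$ be its Haar probability measure (the usual product measure). Let $\mathcal N$ be the family of all $\mu$-null subsets of $2^{\mathbb N}$. A set $X\subseteq 2^{\mathbb N}$ is called $\mathcal N$-additive if for every $N\in\mathcal N$ the set $X+N=\{x+y : x\in X,\ y\in N\}$ belongs to $\mathcal N$. Let $X\subseteq 2^{\mathbb N}$ and let $f:2^{\mathbb N}\to 2^{\mathbb N}$ be a continuous mapping. If $X$ is $\mathcal N$-additive, then so is $f(X)$. -/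

import Mathlib

open scoped Pointwise

/-- The Cantor cube `2^ℕ`, as the group of binary sequences with coordinatewise addition
modulo `2` and the product of the discrete topologies (both are the instances on the
function type `ℕ → ZMod 2`). -/
abbrev CantorCube : Type := ℕ → ZMod 2

/-- The usual product measure on the Cantor cube (its Haar probability measure): the product of
the uniform probability measures on the two-element group. -/
noncomputable def cantorMeasure : MeasureTheory.Measure CantorCube :=
  MeasureTheory.Measure.infinitePi fun _ : ℕ => (PMF.uniformOfFintype (ZMod 2)).toMeasure

/-- The family `𝒩` of null subsets of the Cantor cube. Measures are extended to all
sets as outer measures, so no measurability is required of a null set. -/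
def nullIdeal : Set (Set CantorCube) := {A | cantorMeasure A = 0}

/-- `X` is `J`-additive if `X + A ∈ J` for every `A ∈ J`, where
`X + A = {x + a | x ∈ X, a ∈ A}`. -/
def IsAdditiveFor (J : Set (Set CantorCube)) (X : Set CantorCube) : Prop :=
  ∀ A ∈ J, X + A ∈ J

open MeasureTheory ProbabilityTheory Filter Topology

namespace CantorCube

/-! Null-additivity is equivalent to a combinatorial property that continuous maps visibly preserve:
for every `g`, the set is covered by countably many sets `Y`, each having at most `C * 2 ^ k`
initial segments of length `g k` for all `k`, with `C` depending on `Y`.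

Additivity gives the covering (`isCoveredByFewInitials_of_isAdditiveFor`): the limsup `N` of the
sets `vanishing (g n) n`, of measure `2⁻¹ ^ n`, is null, so a non-null closed `S` misses `X + N`. By
Baire, for each `x ∈ X` some non-null relatively open piece of `S` avoids all `x + vanishing (g n)
n` with `n ≥ m`. Translates by points with different initial segments are independent, so a piece of
fixed measure leaves room for only `O(2 ^ k)` segments of length `g k`.

Conversely (`isAdditiveFor_of_isCoveredByFewInitials`), a null set has small open neighbourhoods,
which split into pieces depending on `g k` coordinates and of measure `O(4⁻¹ ^ k)`. Adding `Y` costs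
a factor `C * 2 ^ k` on each, and the sum remains small.

For the image under `f`, uniform continuity turns `g` into a modulus `h`, and the covering for `h`
is pushed forward (`IsCoveredByFewInitials.image`). -/

instance : IsProbabilityMeasure cantorMeasure := by
  unfold cantorMeasure; infer_instance

instance : cantorMeasure.WeaklyRegular := by
  let _ := TopologicalSpace.upgradeIsCompletelyMetrizable CantorCube
  infer_instance

/-! ### Sets determined by finitely many coordinates -/

/-- Membership in `A` depends only on the coordinates in `S`. -/
def IsDeterminedBy (A : Set CantorCube) (S : Finset ℕ) : Prop :=
  ∀ ⦃x y : CantorCube⦄, (∀ i ∈ S, x i = y i) → x ∈ A → y ∈ A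

namespace IsDeterminedBy

variable {A B : Set CantorCube} {S T : Finset ℕ}

lemma mono (h : IsDeterminedBy A S) (hST : S ⊆ T) : IsDeterminedBy A T :=
  fun _ _ hxy => h fun i hi => hxy i (hST hi)

lemma inter (hA : IsDeterminedBy A S) (hB : IsDeterminedBy B S) : IsDeterminedBy (A ∩ B) S :=
  fun _ _ hxy hx => ⟨hA hxy hx.1, hB hxy hx.2⟩

lemma compl (h : IsDeterminedBy A S) : IsDeterminedBy Aᶜ S :=
  fun _ _ hxy hx hy => hx (h (fun i hi => (hxy i hi).symm) hy)

lemma eq_preimage (h : IsDeterminedBy A S) :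
    A = (fun (z : CantorCube) (i : S) => z i) ⁻¹'
      ((fun (z : CantorCube) (i : S) => z i) '' A) := by
  refine Set.Subset.antisymm (Set.subset_preimage_image _ _) ?_
  rintro z ⟨y, hy, hyz⟩
  exact h (fun i hi => congrFun hyz ⟨i, hi⟩) hy

lemma isClopen (h : IsDeterminedBy A S) : IsClopen A := by
  rw [h.eq_preimage]
  exact (isClopen_discrete _).preimage (by fun_prop)

lemma measurableSet (h : IsDeterminedBy A S) : MeasurableSet A :=
  h.isClopen.isOpen.measurableSet

lemma measure_inter (hA : IsDeterminedBy A S) (hB : IsDeterminedBy B T) (hST : Disjoint S T) :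
    cantorMeasure (A ∩ B) = cantorMeasure A * cantorMeasure B := by
  have hind : iIndepFun (fun (i : ℕ) (z : CantorCube) => z i) cantorMeasure :=
    iIndepFun_infinitePi (X := fun _ z => z) fun _ => measurable_id
  have h := hind.indepFun_finset S T hST fun i => measurable_pi_apply i
  rw [hA.eq_preimage, hB.eq_preimage]
  exact h.measure_inter_preimage_eq_mul _ _ (Set.toFinite _).measurableSet
    (Set.toFinite _).measurableSet

end IsDeterminedBy

lemma isDeterminedBy_cylinder (u : CantorCube) (n : ℕ) :
    IsDeterminedBy (PiNat.cylinder u n) (Finset.range n) := by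
  intro x y hxy hx i hi
  rw [← hxy i (Finset.mem_range.2 hi), hx i hi]

lemma uniform_singleton (a : ZMod 2) :
    (PMF.uniformOfFintype (ZMod 2)).toMeasure {a} = 2⁻¹ := by
  rw [PMF.toMeasure_apply_singleton _ _ (measurableSet_singleton a)]
  simp [PMF.uniformOfFintype_apply, ZMod.card]

lemma measure_forall_eq (x : CantorCube) (S : Finset ℕ) :
    cantorMeasure {z | ∀ i ∈ S, z i = x i} = 2⁻¹ ^ S.card := by
  have h : {z : CantorCube | ∀ i ∈ S, z i = x i} = Set.pi S fun i => {x i} := by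
    ext z; simp [Set.mem_pi]
  rw [h, cantorMeasure, Measure.infinitePi_pi _ fun i _ => measurableSet_singleton _]
  simp only [uniform_singleton, Finset.prod_const]

lemma measure_exists_ne (x : CantorCube) (S : Finset ℕ) :
    cantorMeasure {z | ∃ i ∈ S, z i ≠ x i} = 1 - 2⁻¹ ^ S.card := by
  have hd : IsDeterminedBy {z | ∀ i ∈ S, z i = x i} S := by
    intro y z hyz hy i hi
    rw [← hyz i hi, hy i hi]
  have h : {z : CantorCube | ∃ i ∈ S, z i ≠ x i} = {z | ∀ i ∈ S, z i = x i}ᶜ := by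
    ext z; simp
  rw [h, prob_compl_eq_one_sub hd.measurableSet, measure_forall_eq]

lemma map_add_left (a : CantorCube) :
    cantorMeasure.map (fun z => a + z) = cantorMeasure := by
  have h := Measure.infinitePi_map_pi
    (fun _ : ℕ => (PMF.uniformOfFintype (ZMod 2)).toMeasure)
    (f := fun i z => a i + z) (fun i => measurable_of_countable _)
  refine h.trans ?_
  unfold cantorMeasure
  congr 1
  ext1 i
  refine Measure.ext_of_singleton fun b => ?_
  rw [Measure.map_apply (measurable_of_countable _) (measurableSet_singleton _)]
  have : (fun z => a i + z) ⁻¹' {b} = {b - a i} := by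
    ext z
    rw [Set.mem_preimage, Set.mem_singleton_iff, Set.mem_singleton_iff, eq_sub_iff_add_eq']
  rw [this, uniform_singleton, uniform_singleton]

lemma measure_preimage_sub (a : CantorCube) {A : Set CantorCube} (hA : MeasurableSet A) :
    cantorMeasure {z | z - a ∈ A} = cantorMeasure A := by
  conv_rhs => rw [← map_add_left (-a)]
  rw [Measure.map_apply (by fun_prop) hA]
  congr 1
  ext z
  simp [sub_eq_neg_add]

/-! ### Restrictions and blocks -/

/-- The restriction of a sequence to its first `n` coordinates. -/
def initial (n : ℕ) (z : CantorCube) : Fin n → ZMod 2 := fun i => z i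

lemma initial_eq_iff {n : ℕ} {x y : CantorCube} :
    initial n x = initial n y ↔ ∀ i < n, x i = y i :=
  ⟨fun h i hi => congrFun h ⟨i, hi⟩, fun h => funext fun i => h i i.2⟩

/-- The representatives are taken in `Y` itself so that hypotheses about points of `Y` apply to
them; injectivity is what yields independence later. -/
lemma exists_finset_initial (Y : Set CantorCube) (n : ℕ) :
    ∃ A : Finset CantorCube, ↑A ⊆ Y ∧ Set.InjOn (initial n) A ∧
      ∀ x ∈ Y, ∃ a ∈ A, initial n x = initial n a := by
  obtain ⟨s, hs, hb⟩ := Set.exists_subset_bijOn Y (initial n)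
  have hfin : s.Finite := by
    have : (initial n '' s).Finite := Set.toFinite _
    exact this.of_finite_image hb.injOn
  refine ⟨hfin.toFinset, by simpa using hs, by simpa using hb.injOn, fun x hx => ?_⟩
  obtain ⟨a, ha, hax⟩ := hb.surjOn (Set.mem_image_of_mem _ hx)
  exact ⟨a, by simpa using ha, hax.symm⟩

lemma card_le_two_pow {A : Finset CantorCube} {n : ℕ} (hA : Set.InjOn (initial n) A) :
    A.card ≤ 2 ^ n := by
  calc A.card = (A.image (initial n)).card := (Finset.card_image_of_injOn hA).symm
    _ ≤ Fintype.card (Fin n → ZMod 2) := Finset.card_le_univ _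
    _ = 2 ^ n := by simp [ZMod.card]

/-- A block of `r` coordinates beyond `n`, chosen by an initial segment of length `n`; distinct
initial segments have disjoint blocks. -/
noncomputable def block (n r : ℕ) (s : Fin n → ZMod 2) : Finset ℕ :=
  Finset.Ico (n + Fintype.equivFin _ s * r) (n + (Fintype.equivFin _ s + 1) * r)

lemma card_block (n r : ℕ) (s : Fin n → ZMod 2) : (block n r s).card = r := by
  rw [block, Nat.card_Ico, add_mul]; omega

lemma disjoint_range_block (n r : ℕ) (s : Fin n → ZMod 2) :
    Disjoint (Finset.range n) (block n r s) := by
  rw [Finset.disjoint_left]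
  intro i hi hi'
  rw [block, Finset.mem_Ico] at hi'
  have := Finset.mem_range.1 hi
  omega

lemma disjoint_block {n : ℕ} (r : ℕ) {s t : Fin n → ZMod 2} (hst : s ≠ t) :
    Disjoint (block n r s) (block n r t) := by
  have hne : (Fintype.equivFin _ s : ℕ) ≠ Fintype.equivFin _ t := fun h =>
    hst ((Fintype.equivFin _).injective (Fin.ext h))
  rw [Finset.disjoint_left]
  intro i hi hi'
  rw [block, Finset.mem_Ico] at hi hi'
  rcases lt_or_gt_of_ne hne with h | h
  · have := Nat.mul_le_mul_right r (Nat.succ_le_of_lt h)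
    simp only [Nat.succ_eq_add_one] at this
    omega
  · have := Nat.mul_le_mul_right r (Nat.succ_le_of_lt h)
    simp only [Nat.succ_eq_add_one] at this
    omega

/-- The sequences that vanish on the block of length `r` selected by their first `n`
coordinates. -/
def vanishing (n r : ℕ) : Set CantorCube := {z | ∀ i ∈ block n r (initial n z), z i = 0}

/-- A bound for the coordinates that matter for `vanishing n r`. -/
noncomputable def support (n r : ℕ) : Finset ℕ :=
  Finset.range n ∪ Finset.univ.biUnion fun s => block n r s

lemma isDeterminedBy_vanishing (n r : ℕ) : IsDeterminedBy (vanishing n r) (support n r) := by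
  intro x y hxy hx i hi
  have h : initial n x = initial n y := initial_eq_iff.2 fun j hj =>
    hxy j (Finset.mem_union_left _ (Finset.mem_range.2 hj))
  rw [← h] at hi
  rw [← hxy i (Finset.mem_union_right _ (Finset.mem_biUnion.2 ⟨_, Finset.mem_univ _, hi⟩))]
  exact hx i hi

/-- On the cylinder of `u`, the block selected by `z - x` is the fixed one selected by `u - x`.
These blocks are disjoint for distinct initial segments of `x` and lie beyond `n`, so the events are
independent. -/
lemma measure_cylinder_inter (n r : ℕ) (u : CantorCube) (A : Finset CantorCube)
    (hA : Set.InjOn (initial n) A) :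
    cantorMeasure (PiNat.cylinder u n ∩
        {z | ∀ x ∈ A, ∃ i ∈ block n r (initial n (u - x)), z i ≠ x i}) =
      cantorMeasure (PiNat.cylinder u n) * (1 - 2⁻¹ ^ r) ^ A.card := by
  classical
  induction A using Finset.induction_on with
  | empty => simp
  | insert a A ha ih =>
    have hA' : Set.InjOn (initial n) A := hA.mono (by simp)
    have hset : PiNat.cylinder u n ∩
          {z | ∀ x ∈ insert a A, ∃ i ∈ block n r (initial n (u - x)), z i ≠ x i} =
        (PiNat.cylinder u n ∩
          {z | ∀ x ∈ A, ∃ i ∈ block n r (initial n (u - x)), z i ≠ x i}) ∩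
          {z | ∃ i ∈ block n r (initial n (u - a)), z i ≠ a i} := by
      ext z
      simp only [Finset.forall_mem_insert, Set.mem_inter_iff, Set.mem_ofPred_eq]
      tauto
    have h1 : IsDeterminedBy (PiNat.cylinder u n ∩
          {z | ∀ x ∈ A, ∃ i ∈ block n r (initial n (u - x)), z i ≠ x i})
        (Finset.range n ∪ A.biUnion fun x => block n r (initial n (u - x))) := by
      refine ((isDeterminedBy_cylinder u n).mono Finset.subset_union_left).inter ?_
      intro y z hyz hy x hx
      obtain ⟨i, hi, hne⟩ := hy x hx
      refine ⟨i, hi, ?_⟩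
      rwa [← hyz i (Finset.mem_union_right _ (Finset.mem_biUnion.2 ⟨x, hx, hi⟩))]
    have h2 : IsDeterminedBy {z : CantorCube | ∃ i ∈ block n r (initial n (u - a)), z i ≠ a i}
        (block n r (initial n (u - a))) := by
      rintro y z hyz ⟨i, hi, hne⟩
      exact ⟨i, hi, by rwa [← hyz i hi]⟩
    have hdisj : Disjoint (Finset.range n ∪ A.biUnion fun x => block n r (initial n (u - x)))
        (block n r (initial n (u - a))) := by
      rw [Finset.disjoint_union_left, Finset.disjoint_biUnion_left]
      refine ⟨disjoint_range_block _ _ _, fun x hx => disjoint_block r fun h => ha ?_⟩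
      have hxa : initial n x = initial n a := initial_eq_iff.2 fun i hi => by
        simpa using initial_eq_iff.1 h i hi
      have := hA (by simp [hx]) (by simp) hxa
      rwa [← this]
    rw [hset, h1.measure_inter h2 hdisj, ih hA', measure_exists_ne, card_block,
      Finset.card_insert_of_notMem ha, pow_succ, mul_assoc]

/-- The translates of `vanishing n r` by points with distinct initial segments are independent. -/
lemma measure_forall_sub_notMem_vanishing (n r : ℕ) (A : Finset CantorCube)
    (hA : Set.InjOn (initial n) A) :
    cantorMeasure {z | ∀ x ∈ A, z - x ∉ vanishing n r} = (1 - 2⁻¹ ^ r) ^ A.card := by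
  have hmeas : ∀ s : Fin n → ZMod 2, MeasurableSet (initial n ⁻¹' {s}) := fun s =>
    measurableSet_preimage (by unfold initial; fun_prop) (measurableSet_singleton s)
  -- Condition on the first `n` coordinates: each fibre of `initial n` is a cylinder, on which the
  -- conditional probability is the same.
  have htot : ∀ B : Set CantorCube,
      cantorMeasure B = ∑ s : Fin n → ZMod 2, cantorMeasure (initial n ⁻¹' {s} ∩ B) := by
    intro B
    have h := sum_measure_preimage_singleton (μ := cantorMeasure.restrict B)
      (Finset.univ : Finset (Fin n → ZMod 2)) (f := initial n) fun s _ => hmeas s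
    simp only [Finset.coe_univ, Set.preimage_univ, Measure.restrict_apply_univ] at h
    rw [← h]
    exact Finset.sum_congr rfl fun s _ => Measure.restrict_apply (hmeas s)
  have hone : ∑ s : Fin n → ZMod 2, cantorMeasure (initial n ⁻¹' {s}) = 1 := by
    have := htot Set.univ
    simpa using this.symm
  have hsplit : (1 - 2⁻¹ ^ r : ENNReal) ^ A.card =
      ∑ s : Fin n → ZMod 2, cantorMeasure (initial n ⁻¹' {s}) * (1 - 2⁻¹ ^ r) ^ A.card := by
    rw [← Finset.sum_mul, hone, one_mul]
  rw [htot, hsplit]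
  refine Finset.sum_congr rfl fun s _ => ?_
  obtain ⟨u, rfl⟩ : ∃ u : CantorCube, initial n u = s :=
    ⟨fun i => if h : i < n then s ⟨i, h⟩ else 0, by ext i; simp [initial]⟩
  have hcyl : initial n ⁻¹' {initial n u} = PiNat.cylinder u n := by
    ext z
    simp only [Set.mem_preimage, Set.mem_singleton_iff, initial_eq_iff]
    rfl
  rw [hcyl, ← measure_cylinder_inter n r u A hA]
  congr 1
  ext z
  refine and_congr_right fun hz => forall₂_congr fun x _ => ?_
  have hzx : initial n (z - x) = initial n (u - x) := initial_eq_iff.2 fun i hi => by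
    simp [hz i hi]
  simp only [vanishing, Set.mem_ofPred_eq, hzx, Pi.sub_apply, sub_eq_zero, not_forall,
    exists_prop, ne_eq]

lemma measure_vanishing (n r : ℕ) : cantorMeasure (vanishing n r) = 2⁻¹ ^ r := by
  have h := measure_forall_sub_notMem_vanishing n r {0} (by simp)
  have hc : {z : CantorCube | ∀ x ∈ ({0} : Finset CantorCube), z - x ∉ vanishing n r} =
      (vanishing n r)ᶜ := by
    ext z; simp
  have hm := (isDeterminedBy_vanishing n r).measurableSet
  rw [hc, Finset.card_singleton, pow_one] at h
  rw [← compl_compl (vanishing n r), prob_compl_eq_one_sub hm.compl, h]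
  exact ENNReal.sub_sub_cancel ENNReal.one_ne_top
    (pow_le_one₀ zero_le (by simp))

/-- With `q = 2⁻¹ ^ r`, Bernoulli gives `K * q ≤ (1 + q) ^ K`, and `(1 - q) * (1 + q) ≤ 1`; hence `t
* K * q ≤ 1`. -/
lemma card_le_of_le_pow {t : ENNReal} (ht : t ≠ 0) {r K : ℕ}
    (h : t ≤ (1 - 2⁻¹ ^ r) ^ K) : (K : ENNReal) ≤ t⁻¹ * 2 ^ r := by
  have hp : (2⁻¹ : ENNReal) ^ r ≤ 1 := pow_le_one₀ zero_le (by simp)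
  have htop : t ≠ ⊤ := ne_top_of_le_ne_top (by finiteness) h
  have key : t * (K * 2⁻¹ ^ r) ≤ 1 := by
    have hb : (K : ENNReal) * 2⁻¹ ^ r ≤ (1 + 2⁻¹ ^ r) ^ K := by
      clear h
      induction K with
      | zero => simp
      | succ K ih =>
        have h1 : (1 : ENNReal) ≤ (1 + 2⁻¹ ^ r) ^ K := one_le_pow₀ le_self_add
        calc ((K + 1 : ℕ) : ENNReal) * 2⁻¹ ^ r = K * 2⁻¹ ^ r + 1 * 2⁻¹ ^ r := by
              push_cast; ring
          _ ≤ (1 + 2⁻¹ ^ r) ^ K + (1 + 2⁻¹ ^ r) ^ K * 2⁻¹ ^ r := by gcongr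
          _ = (1 + 2⁻¹ ^ r) ^ (K + 1) := by ring
    have hm : (1 - 2⁻¹ ^ r : ENNReal) * (1 + 2⁻¹ ^ r) ≤ 1 := by
      calc (1 - 2⁻¹ ^ r : ENNReal) * (1 + 2⁻¹ ^ r)
          = (1 - 2⁻¹ ^ r) + (1 - 2⁻¹ ^ r) * 2⁻¹ ^ r := by ring
        _ ≤ (1 - 2⁻¹ ^ r) + 1 * 2⁻¹ ^ r := by gcongr; exact tsub_le_self
        _ = 1 := by rw [one_mul, tsub_add_cancel_of_le hp]
    calc t * (K * 2⁻¹ ^ r) ≤ (1 - 2⁻¹ ^ r) ^ K * (1 + 2⁻¹ ^ r) ^ K := by gcongr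
      _ = ((1 - 2⁻¹ ^ r) * (1 + 2⁻¹ ^ r)) ^ K := (mul_pow _ _ _).symm
      _ ≤ 1 := pow_le_one₀ zero_le hm
  calc (K : ENNReal) = (t⁻¹ * t) * K * (2⁻¹ ^ r * 2 ^ r) := by
        rw [ENNReal.inv_mul_cancel ht htop, ← mul_pow,
          ENNReal.inv_mul_cancel (by simp) (by simp)]
        simp
    _ = t⁻¹ * (t * (K * 2⁻¹ ^ r)) * 2 ^ r := by ring
    _ ≤ t⁻¹ * 1 * 2 ^ r := by gcongr
    _ = t⁻¹ * 2 ^ r := by rw [mul_one]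

/-! ### Combinatorial characterization of null-additive sets -/

/-- Up to a constant factor, `Y` has at most `2 ^ k` initial segments of length `g k`. -/
def HasFewInitials (g : ℕ → ℕ) (Y : Set CantorCube) : Prop :=
  ∃ C : ℕ, ∀ k, ∃ A : Finset CantorCube, A.card ≤ C * 2 ^ k ∧
    ∀ x ∈ Y, ∃ a ∈ A, initial (g k) x = initial (g k) a

/-- For every `g`, the set `X` is covered by countably many sets with few initial segments of
lengths `g 0, g 1, …`. -/
def IsCoveredByFewInitials (X : Set CantorCube) : Prop :=
  ∀ g : ℕ → ℕ, ∃ 𝒴 : Set (Set CantorCube), 𝒴.Countable ∧ X ⊆ ⋃₀ 𝒴 ∧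
    ∀ Y ∈ 𝒴, HasFewInitials g Y

lemma hasFewInitials_of_avoids {g : ℕ → ℕ} {Y E : Set CantorCube} (hE : cantorMeasure E ≠ 0)
    {m : ℕ} (h : ∀ x ∈ Y, ∀ z ∈ E, ∀ n ≥ m, z - x ∉ vanishing (g n) n) :
    HasFewInitials g Y := by
  obtain ⟨c, hc⟩ := ENNReal.exists_nat_gt (ENNReal.inv_ne_top.2 hE)
  -- Independence only helps for `k ≥ m`, where `c` suffices; the sum absorbs the trivial bound `2 ^
  -- g k` for `k < m`.
  refine ⟨c + ∑ n ∈ Finset.range m, 2 ^ g n, fun k => ?_⟩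
  obtain ⟨A, hAY, hinj, hcov⟩ := exists_finset_initial Y (g k)
  refine ⟨A, ?_, hcov⟩
  rcases lt_or_ge k m with hk | hk
  · calc A.card ≤ 2 ^ g k := card_le_two_pow hinj
      _ ≤ ∑ n ∈ Finset.range m, 2 ^ g n :=
        Finset.single_le_sum (f := fun n => 2 ^ g n) (fun _ _ => Nat.zero_le _)
          (Finset.mem_range.2 hk)
      _ ≤ c + ∑ n ∈ Finset.range m, 2 ^ g n := Nat.le_add_left _ _
      _ ≤ _ := Nat.le_mul_of_pos_right _ (by positivity)
  · have hle : cantorMeasure E ≤ (1 - 2⁻¹ ^ k) ^ A.card := by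
      rw [← measure_forall_sub_notMem_vanishing (g k) k A hinj]
      exact measure_mono fun z hz x hx => h x (hAY hx) z hz k hk
    have h1 : (A.card : ENNReal) ≤ ((c * 2 ^ k : ℕ) : ENNReal) := by
      push_cast
      exact (card_le_of_le_pow hE hle).trans (by gcongr)
    exact (Nat.cast_le.1 h1).trans (by gcongr; exact Nat.le_add_right _ _)

/-- Every non-null closed set contains a closed set all of whose nonempty relatively open subsets
are non-null. -/
lemma exists_isClosed_self_supporting {T : Set CantorCube} (hT : IsClosed T)
    (hT0 : cantorMeasure T ≠ 0) :
    ∃ S ⊆ T, IsClosed S ∧ S.Nonempty ∧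
      ∀ U, IsOpen U → (S ∩ U).Nonempty → cantorMeasure (S ∩ U) ≠ 0 := by
  set 𝓑 := TopologicalSpace.countableBasis CantorCube
  have hbasis := TopologicalSpace.isBasis_countableBasis CantorCube
  set V : Set CantorCube := ⋃₀ {B ∈ 𝓑 | cantorMeasure (T ∩ B) = 0} with hV
  have hVopen : IsOpen V := isOpen_sUnion fun B hB => hbasis.isOpen hB.1
  have hVnull : cantorMeasure (T ∩ V) = 0 := by
    rw [hV, Set.sUnion_eq_biUnion, Set.inter_iUnion₂]
    exact (measure_biUnion_null_iff
      ((TopologicalSpace.countable_countableBasis CantorCube).mono fun _ h => h.1)).2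
      fun B hB => hB.2
  -- Removing `V` changes no measure, so a null relatively open piece of `T \ V` would already lie
  -- in `V`.
  have hdiff : ∀ U, cantorMeasure ((T \ V) ∩ U) = cantorMeasure (T ∩ U) := by
    intro U
    refine le_antisymm (measure_mono (by gcongr; exact Set.sdiff_subset)) ?_
    calc cantorMeasure (T ∩ U) ≤ cantorMeasure (((T \ V) ∩ U) ∪ (T ∩ V)) :=
          measure_mono fun z hz => by
            by_cases hzV : z ∈ V
            · exact Or.inr ⟨hz.1, hzV⟩
            · exact Or.inl ⟨⟨hz.1, hzV⟩, hz.2⟩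
      _ ≤ cantorMeasure ((T \ V) ∩ U) + cantorMeasure (T ∩ V) := measure_union_le _ _
      _ = _ := by rw [hVnull, add_zero]
  refine ⟨T \ V, Set.sdiff_subset, hT.sdiff hVopen, ?_, ?_⟩
  · have := hdiff Set.univ
    rw [Set.inter_univ, Set.inter_univ] at this
    exact nonempty_of_measure_ne_zero (this ▸ hT0)
  · rintro U hU ⟨z, ⟨hzT, hzV⟩, hzU⟩ h0
    obtain ⟨B, hB, hzB, hBU⟩ := hbasis.exists_subset_of_mem_open hzU hU
    refine hzV ⟨B, ⟨hB, ?_⟩, hzB⟩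
    rw [hdiff] at h0
    exact measure_mono_null (by gcongr) h0

lemma exists_isClosed_of_measure_eq_zero {A : Set CantorCube} (hA : cantorMeasure A = 0) :
    ∃ T, IsClosed T ∧ cantorMeasure T ≠ 0 ∧ Disjoint T A := by
  set B := toMeasurable cantorMeasure A
  have hB : MeasurableSet B := measurableSet_toMeasurable _ _
  have h1 : cantorMeasure Bᶜ = 1 := by
    rw [prob_compl_eq_one_sub hB, measure_toMeasurable, hA, tsub_zero]
  obtain ⟨T, hTB, hT, hpos⟩ := hB.compl.exists_lt_isClosed_of_ne_top (by rw [h1]; simp)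
    (r := 0) (by rw [h1]; simp)
  exact ⟨T, hT, hpos.ne', Set.disjoint_left.2 fun z hz hzA =>
    hTB hz (subset_toMeasurable _ _ hzA)⟩

theorem isCoveredByFewInitials_of_isAdditiveFor {X : Set CantorCube}
    (hX : IsAdditiveFor nullIdeal X) : IsCoveredByFewInitials X := by
  intro g
  set N : Set CantorCube := limsup (fun n => vanishing (g n) n) atTop with hN
  have hNnull : cantorMeasure N = 0 := by
    refine measure_limsup_atTop_eq_zero ?_
    simp only [measure_vanishing, ENNReal.tsum_geometric]
    simp
  obtain ⟨T, hTc, hT0, hTd⟩ := exists_isClosed_of_measure_eq_zero (hX N hNnull)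
  obtain ⟨S, hST, hSc, hSne, hS⟩ := exists_isClosed_self_supporting hTc hT0
  set 𝓑 := TopologicalSpace.countableBasis CantorCube
  have hbasis := TopologicalSpace.isBasis_countableBasis CantorCube
  let Y : Set CantorCube → ℕ → Set CantorCube := fun U m =>
    {x | ∀ z ∈ S ∩ U, ∀ n ≥ m, z - x ∉ vanishing (g n) n}
  refine ⟨Set.image2 Y {U ∈ 𝓑 | (S ∩ U).Nonempty} Set.univ, ?_, ?_, ?_⟩
  · exact ((TopologicalSpace.countable_countableBasis CantorCube).mono fun _ h => h.1).image2
      (Set.to_countable _) _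
  · intro x hx
    have hclosed : ∀ m, IsClosed {z : S | ∀ n ≥ m, (z : CantorCube) - x ∉ vanishing (g n) n} := by
      intro m
      simp only [Set.ofPred_forall]
      refine isClosed_iInter fun n => isClosed_iInter fun _ => ?_
      exact (isDeterminedBy_vanishing (g n) n).compl.isClopen.isClosed.preimage
        (continuous_subtype_val.sub continuous_const)
    have hcover : ⋃ m, {z : S | ∀ n ≥ m, (z : CantorCube) - x ∉ vanishing (g n) n} =
        Set.univ := by
      refine Set.eq_univ_of_forall fun z => Set.mem_iUnion.2 ?_
      have hz : (z : CantorCube) - x ∉ N := fun hzN =>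
        Set.disjoint_left.1 hTd (hST z.2) ⟨x, hx, _, hzN, add_sub_cancel _ _⟩
      rw [hN, Filter.mem_limsup_iff_frequently_mem, not_frequently, eventually_atTop] at hz
      exact hz
    have : Nonempty S := hSne.to_subtype
    have : CompactSpace S := isCompact_iff_compactSpace.1 hSc.isCompact
    -- Baire category in the compact space `S`: one `m` works on a whole relatively open piece,
    -- which can be shrunk to a basic one, so countably many pairs `(U, m)` suffice.
    obtain ⟨m, z, hz⟩ := nonempty_interior_of_iUnion_of_closed hclosed hcover
    obtain ⟨V, hVsub, hVopen, hzV⟩ := mem_interior.1 hz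
    obtain ⟨W, hW, rfl⟩ := isOpen_induced_iff.1 hVopen
    obtain ⟨U, hU, hzU, hUW⟩ := hbasis.exists_subset_of_mem_open hzV hW
    refine ⟨Y U m, ⟨U, ⟨hU, z, z.2, hzU⟩, m, trivial, rfl⟩, ?_⟩
    intro w hw
    have hwW : (⟨w, hw.1⟩ : S) ∈ Subtype.val ⁻¹' W := hUW hw.2
    have hmem := hVsub hwW
    rw [Set.mem_ofPred_eq] at hmem
    exact hmem
  · rintro _ ⟨U, ⟨hU, hne⟩, m, -, rfl⟩
    exact hasFewInitials_of_avoids (hS U (hbasis.isOpen hU) hne) fun x hx z hz => hx z hz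

/-! ### Few initial segments imply null-additivity -/

/-- The points whose cylinder of length `n` is contained in `U`. -/
def inner (U : Set CantorCube) (n : ℕ) : Set CantorCube := {y | PiNat.cylinder y n ⊆ U}

lemma isDeterminedBy_inner (U : Set CantorCube) (n : ℕ) :
    IsDeterminedBy (inner U n) (Finset.range n) := by
  intro x y hxy hx z hz
  refine hx fun i hi => ?_
  rw [hxy i (Finset.mem_range.2 hi)]
  exact hz i hi

lemma inner_subset (U : Set CantorCube) (n : ℕ) : inner U n ⊆ U :=
  fun y hy => hy (PiNat.self_mem_cylinder y n)

lemma inner_mono (U : Set CantorCube) : Monotone (inner U) :=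
  fun _ _ hmn _ hy => (PiNat.cylinder_anti _ hmn).trans hy

lemma exists_cylinder_subset {U : Set CantorCube} (hU : IsOpen U) {x : CantorCube} (hx : x ∈ U) :
    ∃ n, PiNat.cylinder x n ⊆ U := by
  obtain ⟨_, ⟨y, n, rfl⟩, hxy, hsub⟩ :=
    (PiNat.isTopologicalBasis_cylinders fun _ : ℕ => ZMod 2).exists_subset_of_mem_open hx hU
  exact ⟨n, by rwa [PiNat.mem_cylinder_iff_eq.1 hxy]⟩

lemma tendsto_measure_diff_inner {U : Set CantorCube} (hU : IsOpen U) :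
    Tendsto (fun n => cantorMeasure (U \ inner U n)) atTop (𝓝 0) := by
  have h := tendsto_measure_iInter_atTop (μ := cantorMeasure) (s := fun n => U \ inner U n)
    (fun n => (hU.measurableSet.diff (isDeterminedBy_inner U n).measurableSet).nullMeasurableSet)
    (fun m n hmn => Set.sdiff_subset_sdiff_right (inner_mono U hmn)) ⟨0, by finiteness⟩
  have he : ⋂ n, U \ inner U n = ∅ := by
    refine Set.eq_empty_of_forall_notMem fun x hx => ?_
    rw [Set.mem_iInter] at hx
    obtain ⟨n, hn⟩ := exists_cylinder_subset hU (hx 0).1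
    exact (hx n).2 hn
  rwa [he, measure_empty] at h

lemma measure_add_le {Y P : Set CantorCube} {n : ℕ} (hP : IsDeterminedBy P (Finset.range n))
    {A : Finset CantorCube} (hA : ∀ x ∈ Y, ∃ a ∈ A, initial n x = initial n a) :
    cantorMeasure (Y + P) ≤ A.card * cantorMeasure P := by
  have hsub : Y + P ⊆ ⋃ a ∈ A, {z | z - a ∈ P} := by
    rintro _ ⟨x, hx, y, hy, rfl⟩
    obtain ⟨a, ha, hxa⟩ := hA x hx
    refine Set.mem_iUnion₂.2 ⟨a, ha, hP (fun i hi => ?_) hy⟩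
    simp [initial_eq_iff.1 hxa i (Finset.mem_range.1 hi)]
  calc cantorMeasure (Y + P) ≤ ∑ a ∈ A, cantorMeasure {z | z - a ∈ P} :=
        (measure_mono hsub).trans (measure_biUnion_finset_le _ _)
    _ = A.card * cantorMeasure P := by
        simp only [measure_preimage_sub _ hP.measurableSet, Finset.sum_const, nsmul_eq_mul]

/-- Sort the points of `U` by the first level `p + j` at which `inner U (g (p + j))` contains them.
The piece at level `k` has measure at most `4 * 4⁻¹ ^ k`, and adding `Y` amounts to at most `C * 2 ^
k` translates, so the bounds form a geometric series. -/
lemma measure_add_open_le {g : ℕ → ℕ} (hg : StrictMono g) {Y U : Set CantorCube} (hU : IsOpen U)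
    {C p : ℕ} (hY : ∀ k, ∃ A : Finset CantorCube, A.card ≤ C * 2 ^ k ∧
      ∀ x ∈ Y, ∃ a ∈ A, initial (g k) x = initial (g k) a)
    (hUp : cantorMeasure U ≤ 4⁻¹ ^ p)
    (hUg : ∀ k ≥ p, cantorMeasure (U \ inner U (g k)) ≤ 4⁻¹ ^ k) :
    cantorMeasure (Y + U) ≤ 8 * C * 2⁻¹ ^ p := by
  let P : ℕ → Set CantorCube := fun j =>
    inner U (g (p + j)) ∩ {y | ∀ i < j, y ∉ inner U (g (p + i))}
  have hPdet : ∀ j, IsDeterminedBy (P j) (Finset.range (g (p + j))) := by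
    intro j
    refine (isDeterminedBy_inner U _).inter fun x y hxy hx i hi => ?_
    refine ((isDeterminedBy_inner U (g (p + i))).compl.mono ?_) hxy (hx i hi)
    exact Finset.range_mono (hg.monotone (by omega))
  -- A piece at level `p + j + 1` is controlled by what was missed at level `p + j`; the factor `4`
  -- pays for this shift.
  have hPmeas : ∀ j, cantorMeasure (P j) ≤ 4 * 4⁻¹ ^ (p + j) := by
    intro j
    cases j with
    | zero =>
      calc cantorMeasure (P 0) ≤ cantorMeasure U :=
            measure_mono (Set.inter_subset_left.trans (inner_subset _ _))
        _ ≤ 4⁻¹ ^ p := hUp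
        _ ≤ 4 * 4⁻¹ ^ (p + 0) := le_mul_of_one_le_left zero_le (by norm_num)
    | succ j =>
      calc cantorMeasure (P (j + 1)) ≤ cantorMeasure (U \ inner U (g (p + j))) :=
            measure_mono fun y hy => ⟨inner_subset _ _ hy.1, hy.2 j (Nat.lt_succ_self j)⟩
        _ ≤ 4⁻¹ ^ (p + j) := hUg _ (Nat.le_add_right _ _)
        _ = 4 * 4⁻¹ ^ (p + (j + 1)) := by
          rw [← add_assoc, pow_succ, mul_comm, mul_assoc,
            ENNReal.inv_mul_cancel (by simp) (by simp), mul_one]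
  have hsub : Y + U ⊆ ⋃ j, (Y + P j) := by
    rw [← Set.add_iUnion]
    refine Set.add_subset_add_left fun y hy => ?_
    obtain ⟨n, hn⟩ := exists_cylinder_subset hU hy
    have hex : ∃ j, y ∈ inner U (g (p + j)) :=
      ⟨n, inner_mono U ((Nat.le_add_left n p).trans hg.le_apply) hn⟩
    classical
    exact Set.mem_iUnion.2 ⟨Nat.find hex, Nat.find_spec hex, fun i hi => Nat.find_min hex hi⟩
  have hterm : ∀ j, cantorMeasure (Y + P j) ≤ 4 * C * 2⁻¹ ^ p * 2⁻¹ ^ j := by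
    intro j
    obtain ⟨A, hAc, hA⟩ := hY (p + j)
    have h24 : (2 : ENNReal) ^ (p + j) * 4⁻¹ ^ (p + j) = 2⁻¹ ^ (p + j) := by
      rw [← mul_pow]
      congr 1
      rw [show (4 : ENNReal) = 2 * 2 by norm_num, ENNReal.mul_inv (by simp) (by simp),
        ← mul_assoc, ENNReal.mul_inv_cancel (by simp) (by simp), one_mul]
    calc cantorMeasure (Y + P j) ≤ A.card * cantorMeasure (P j) := measure_add_le (hPdet j) hA
      _ ≤ ((C * 2 ^ (p + j) : ℕ) : ENNReal) * (4 * 4⁻¹ ^ (p + j)) := by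
          gcongr
          exact hPmeas j
      _ = 4 * C * (2 ^ (p + j) * 4⁻¹ ^ (p + j)) := by push_cast; ring
      _ = 4 * C * 2⁻¹ ^ p * 2⁻¹ ^ j := by rw [h24, pow_add]; ring
  calc cantorMeasure (Y + U) ≤ ∑' j, cantorMeasure (Y + P j) :=
        (measure_mono hsub).trans (measure_iUnion_le _)
    _ ≤ ∑' j, (4 * C * 2⁻¹ ^ p * 2⁻¹ ^ j : ENNReal) := ENNReal.tsum_le_tsum hterm
    _ = 8 * C * 2⁻¹ ^ p := by
        rw [ENNReal.tsum_mul_left, ENNReal.tsum_geometric, ENNReal.one_sub_inv_two, inv_inv]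
        ring

theorem isAdditiveFor_of_isCoveredByFewInitials {X : Set CantorCube}
    (hX : IsCoveredByFewInitials X) : IsAdditiveFor nullIdeal X := by
  intro N hN
  have hN0 : cantorMeasure N = 0 := hN
  have hexU : ∀ p : ℕ, ∃ U ⊇ N, IsOpen U ∧ cantorMeasure U < 4⁻¹ ^ p := fun p =>
    N.exists_isOpen_lt_of_lt _ (by rw [hN0]; exact ENNReal.pow_pos (by simp) p)
  choose U hNU hUo hUm using hexU
  -- Diagonal choice: `g k` handles only the finitely many `U p` with `p ≤ k`, so a single `g`
  -- serves every `p`.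
  obtain ⟨g, hg, hgU⟩ := extraction_forall_of_eventually
    (P := fun k n => ∀ p ≤ k, cantorMeasure (U p \ inner (U p) n) ≤ 4⁻¹ ^ k) fun k => by
      have : ∀ p ∈ Finset.range (k + 1), ∀ᶠ n in atTop,
          cantorMeasure (U p \ inner (U p) n) ≤ 4⁻¹ ^ k := fun p _ =>
        (tendsto_measure_diff_inner (hUo p)).eventually_le_const
          (ENNReal.pow_pos (by simp) k)
      filter_upwards [(Filter.eventually_all_finset _).2 this] with n hn p hp
      exact hn p (Finset.mem_range.2 (Nat.lt_succ_of_le hp))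
  obtain ⟨𝒴, hcount, hcov, hfew⟩ := hX g
  have hnull : ∀ Y ∈ 𝒴, cantorMeasure (Y + N) = 0 := by
    intro Y hY
    obtain ⟨C, hC⟩ := hfew Y hY
    have hle : ∀ p : ℕ, cantorMeasure (Y + N) ≤ 8 * C * 2⁻¹ ^ p := fun p =>
      (measure_mono (Set.add_subset_add_left (hNU p))).trans
        (measure_add_open_le hg (hUo p) hC (hUm p).le fun k hk => hgU k p hk)
    have hlim : Tendsto (fun p : ℕ => (8 * C * 2⁻¹ ^ p : ENNReal)) atTop (𝓝 (8 * C * 0)) :=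
      ENNReal.Tendsto.const_mul
        (ENNReal.tendsto_pow_atTop_nhds_zero_of_lt_one (by simp))
        (Or.inr (by finiteness))
    rw [mul_zero] at hlim
    exact le_antisymm (ge_of_tendsto' hlim hle) zero_le
  refine measure_mono_null (t := ⋃ Y ∈ 𝒴, (Y + N)) ?_
    ((measure_biUnion_null_iff hcount).2 hnull)
  rintro _ ⟨x, hx, y, hy, rfl⟩
  obtain ⟨Y, hY, hxY⟩ := hcov hx
  exact Set.mem_iUnion₂.2 ⟨Y, hY, x, hxY, y, hy, rfl⟩

/-! ### Continuous images -/

/-- Uniform continuity, from compactness of the cube. -/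
lemma exists_initial_modulus {f : CantorCube → CantorCube} (hf : Continuous f) (n : ℕ) :
    ∃ m, ∀ x y, initial m x = initial m y → initial n (f x) = initial n (f y) := by
  have hloc : ∀ x, ∃ m, PiNat.cylinder x m ⊆ f ⁻¹' PiNat.cylinder (f x) n := fun x =>
    exists_cylinder_subset ((PiNat.isOpen_cylinder _ (f x) n).preimage hf)
      (PiNat.self_mem_cylinder _ _)
  choose m hm using hloc
  obtain ⟨t, -, ht⟩ := isCompact_univ.elim_nhds_subcover
    (fun x : CantorCube => PiNat.cylinder x (m x)) fun x _ =>
      (PiNat.isOpen_cylinder _ x (m x)).mem_nhds (PiNat.self_mem_cylinder _ _)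
  refine ⟨t.sup m, fun x y hxy => initial_eq_iff.2 fun i hi => ?_⟩
  obtain ⟨w, hw, hxw⟩ := Set.mem_iUnion₂.1 (ht (Set.mem_univ x))
  have hyw : y ∈ PiNat.cylinder w (m w) := fun j hj => by
    rw [← initial_eq_iff.1 hxy j (hj.trans_le (Finset.le_sup hw)), hxw j hj]
  rw [hm w hxw i hi, hm w hyw i hi]

theorem IsCoveredByFewInitials.image {X : Set CantorCube} (hX : IsCoveredByFewInitials X)
    {f : CantorCube → CantorCube} (hf : Continuous f) : IsCoveredByFewInitials (f '' X) := by
  classical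
  intro g
  choose h hh using fun k => exists_initial_modulus hf (g k)
  obtain ⟨𝒴, hcount, hcov, hfew⟩ := hX h
  refine ⟨Set.image f '' 𝒴, hcount.image _, ?_, ?_⟩
  · rintro _ ⟨x, hx, rfl⟩
    obtain ⟨Y, hY, hxY⟩ := hcov hx
    exact ⟨f '' Y, ⟨Y, hY, rfl⟩, x, hxY, rfl⟩
  · rintro _ ⟨Y, hY, rfl⟩
    obtain ⟨C, hC⟩ := hfew Y hY
    refine ⟨C, fun k => ?_⟩
    obtain ⟨A, hAc, hA⟩ := hC k
    refine ⟨A.image f, Finset.card_image_le.trans hAc, ?_⟩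
    rintro _ ⟨x, hx, rfl⟩
    obtain ⟨a, ha, hxa⟩ := hA x hx
    exact ⟨f a, Finset.mem_image_of_mem f ha, hh k x a hxa⟩

end CantorCube

theorem mainTheorem7 (f : CantorCube → CantorCube) (hf : Continuous f)
    (X : Set CantorCube) (hX : IsAdditiveFor nullIdeal X) :
    IsAdditiveFor nullIdeal (f '' X) :=
  CantorCube.isAdditiveFor_of_isCoveredByFewInitials
    ((CantorCube.isCoveredByFewInitials_of_isAdditiveFor hX).image hf)
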